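/- Let $n\ge 1$ and write $[n]=\{1,\dots,n\}$. A Latin square of order $n$ is a map $L:[n]\times[n]\to[n]$ such that every symbol $k\in[n]$ occurs exactly once in each row and exactly once in each column. For $X,Y,Z\subseteq[n]$, the box $X\times Y\times Z$ is called empty in $L$ if there is no $(i,j,k)\in X\times Y\times Z$ with $L(i,j)=k$, and its volume is $|X||Y||Z|$. Let $\varepsilon(L)$ denote the maximal volume of an empty box in $L$. Theorem. Asymptotically almost every Latin square $L$ of order $n$ satisfies $\varepsilon(L)=O(n^2\log^2 n)$. That is, there is an absolute constant $C>0$ such that, for $L$ chosen uniformly at random among all Latin squares of order $n$, $$\lim_{n\to\infty}\Pr\bigl(\varepsilon(L)\le C\,n^2(\log n)^2\bigr)=1 .$$ -/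

import Mathlib

/-- `L` is a Latin square of order `n`: each symbol occurs exactly once in every row and exactly
once in every column. -/
def IsLatinSquare {n : ℕ} (L : Fin n → Fin n → Fin n) : Prop :=
  (∀ i, Function.Bijective (fun j => L i j)) ∧ (∀ j, Function.Bijective (fun i => L i j))

/-- The number `L(X, Y, Z)` of triples `(i, j, k) ∈ X × Y × Z` with `L i j = k`. -/
def boxCount {n : ℕ} (L : Fin n → Fin n → Fin n) (X Y Z : Finset (Fin n)) : ℕ :=
  ((X ×ˢ Y ×ˢ Z).filter (fun t => L t.1 t.2.1 = t.2.2)).card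

/-- The box `X × Y × Z` is empty in `L`. -/
def IsEmptyBox {n : ℕ} (L : Fin n → Fin n → Fin n) (X Y Z : Finset (Fin n)) : Prop :=
  boxCount L X Y Z = 0

open Classical in
/-- `ε(L)`: the maximal volume `|X| |Y| |Z|` of an empty box `X × Y × Z` in `L`. -/
noncomputable def maxEmptyBoxVolume {n : ℕ} (L : Fin n → Fin n → Fin n) : ℕ :=
  ((Finset.univ : Finset (Finset (Fin n) × Finset (Fin n) × Finset (Fin n))).filter
    (fun T => IsEmptyBox L T.1 T.2.1 T.2.2)).sup (fun T => T.1.card * T.2.1.card * T.2.2.card)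

open Classical in
/-- The finite set of all Latin squares of order `n`. -/
noncomputable def latinSquares (n : ℕ) : Finset (Fin n → Fin n → Fin n) :=
  Finset.univ.filter IsLatinSquare

open Classical in
/-- The probability that a uniformly random Latin square of order `n` has the property `P`. -/
noncomputable def latinSquareProb (n : ℕ) (P : (Fin n → Fin n → Fin n) → Prop) : ℝ :=
  (((latinSquares n).filter P).card : ℝ) / ((latinSquares n).card : ℝ)

/-! The proof compares two counts. There are at least (n!)^n e^{-n²} Latin squares, and at most
(n!)^n e^{-n²} exp(2n(log n + 1)² - |X||Y||Z|/n) of them leave a given box X × Y × Z with Y nonempty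
empty. The main terms cancel exactly, so a fixed box of volume above 12 n² log² n is empty with
probability small enough to survive a union bound over all 8^n boxes.

Both counts build the square row by row: a row placed below m others is a perfect matching between
the columns and the symbols still available in them.

For the lower count this bipartite graph is (n-m)-regular, so it has at least ((n-m)/e)^n perfect
matchings. This follows from the bound e^{-n} for permanents of doubly stochastic matrices, proved
by Gurvits' method: the permanent is the coefficient of x_1⋯x_n in a product of linear forms, and
extracting the linear coefficient in one variable keeps a polynomial stable and costs at most a
factor e in capacity, the infimum of q(x)/∏ x_i over positive x.

For the upper count, Brègman's theorem (`log_card_matchings_le`) bounds the matchings by the product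
of (d!)^{1/d} over the columns, where d is the number of available symbols. Its logarithm per column
is at most log d - 1 plus an error of order (log n)/d; over all cells these errors sum harmonically
to O(n log² n). Each of the |X||Y| restricted cells has |Z| fewer symbols available, which lowers
log d by at least |Z|/n. -/

/-! ### Stable polynomials and Gurvits' capacity induction -/

open Polynomial in
/-- The slice of a multivariate polynomial in its first variable, at a point of an algebra. -/
noncomputable def MvPolynomial.firstSlice {R A : Type*} [CommRing R] [CommRing A] [Algebra R A]
    {n : ℕ} (q : MvPolynomial (Fin (n + 1)) R) (z : Fin n → A) : A[X] :=
  (finSuccEquiv R n q).map ((aeval z : MvPolynomial (Fin n) R →ₐ[R] A) : MvPolynomial (Fin n) R →+* A)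

open MvPolynomial in
theorem eval_firstSlice {R A : Type*} [CommRing R] [CommRing A] [Algebra R A]
    {n : ℕ} (q : MvPolynomial (Fin (n + 1)) R) (z : Fin n → A) (t : A) :
    (firstSlice q z).eval t = aeval (Fin.cons t z : Fin (n + 1) → A) q := by
  induction q using MvPolynomial.induction_on with
  | C a => simp [firstSlice, finSuccEquiv_apply]
  | add p q hp hq => simp only [firstSlice, map_add, Polynomial.map_add, Polynomial.eval_add] at *
                     rw [hp, hq]
  | mul_X p i hp =>
    simp only [firstSlice, map_mul, Polynomial.map_mul, Polynomial.eval_mul] at *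
    rw [hp]
    congr 1
    refine Fin.cases ?_ (fun j => ?_) i
    · simp [finSuccEquiv_X_zero]
    · simp [finSuccEquiv_X_succ]

open MvPolynomial in
theorem coeff_firstSlice {R A : Type*} [CommRing R] [CommRing A] [Algebra R A]
    {n : ℕ} (q : MvPolynomial (Fin (n + 1)) R) (z : Fin n → A) (k : ℕ) :
    (firstSlice q z).coeff k = aeval z ((finSuccEquiv R n q).coeff k) := by
  simp [firstSlice, Polynomial.coeff_map]

open MvPolynomial in
theorem map_firstSlice_ofReal {n : ℕ} (q : MvPolynomial (Fin (n + 1)) ℝ) (x : Fin n → ℝ) :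
    (firstSlice q x).map (algebraMap ℝ ℂ) = firstSlice q (fun i => (x i : ℂ)) := by
  ext k
  rw [Polynomial.coeff_map, coeff_firstSlice, coeff_firstSlice]
  exact (aeval_algebraMap_apply ℂ x _).symm

open MvPolynomial in
theorem aeval_mul_of_isHomogeneous {R A σ : Type*} [CommRing R] [CommRing A] [Algebra R A]
    {q : MvPolynomial σ R} {k : ℕ} (hq : q.IsHomogeneous k) (c : A) (z : σ → A) :
    aeval (fun i => c * z i) q = c ^ k * aeval z q := by
  rw [aeval_def, aeval_def, eval₂_eq, eval₂_eq, Finset.mul_sum]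
  refine Finset.sum_congr rfl fun d hd => ?_
  have h : ∑ i ∈ d.support, d i = k := (hq.degree_eq_sum_deg_support hd).symm
  rw [← h]
  simp only [mul_pow, Finset.prod_mul_distrib, Finset.prod_pow_eq_pow_sum]
  ring

open MvPolynomial in
theorem aeval_isHomogeneous_zero_eq {R A σ : Type*} [CommRing R] [CommRing A] [Algebra R A]
    {q : MvPolynomial σ R} (hq : q.IsHomogeneous 0) (z : σ → A) :
    aeval z q = algebraMap R A (coeff 0 q) := by
  have h : q = C (coeff 0 q) := by
    apply totalDegree_eq_zero_iff_eq_C.mp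
    exact Nat.le_zero.mp hq.totalDegree_le
  conv_lhs => rw [h]
  simp

/-- A homogeneous real polynomial of degree equal to its number of variables, without nonzero zeros
all of whose nonzero coordinates lie in the open right half-plane, and positive on the nonnegative
orthant. -/
structure IsHalfPlaneStable {k : ℕ} (q : MvPolynomial (Fin k) ℝ) : Prop where
  homogeneous : q.IsHomogeneous k
  aeval_ne_zero : ∀ z : Fin k → ℂ, (∀ i, z i = 0 ∨ 0 < (z i).re) → z ≠ 0 → MvPolynomial.aeval z q ≠ 0
  aeval_pos : ∀ x : Fin k → ℝ, (∀ i, 0 ≤ x i) → x ≠ 0 → 0 < MvPolynomial.aeval x q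

theorem Fin.cons_ne_zero_of_left {A : Type*} [Zero A] {n : ℕ} {t : A} {z : Fin n → A}
    (h : t ≠ 0) : (Fin.cons t z : Fin (n + 1) → A) ≠ 0 := fun h' => h (by simpa using congrFun h' 0)

theorem Fin.cons_ne_zero_of_right {A : Type*} [Zero A] {n : ℕ} {t : A} {z : Fin n → A}
    (h : z ≠ 0) : (Fin.cons t z : Fin (n + 1) → A) ≠ 0 :=
  fun h' => h (funext fun i => by simpa using congrFun h' i.succ)

namespace IsHalfPlaneStable

open MvPolynomial

variable {n : ℕ} {q : MvPolynomial (Fin (n + 1)) ℝ}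

/-- The new point is that t may lie on the imaginary axis. By homogeneity all coordinates may be
multiplied by a common factor; a slight rotation moves a nonzero t into the open half-plane without
pushing the other coordinates out of it. -/
theorem firstSlice_eval_ne_zero (hq : IsHalfPlaneStable q) {z : Fin n → ℂ}
    (hz : ∀ i, z i = 0 ∨ 0 < (z i).re) (hz0 : z ≠ 0) {t : ℂ} (ht : 0 ≤ t.re) :
    (firstSlice q z).eval t ≠ 0 := by
  rw [eval_firstSlice]
  intro h
  have h1 : ∀ᶠ d : ℝ in nhdsWithin 0 (Set.Ioi 0),
      ∀ i, z i = 0 ∨ 0 < (z i).re + d * t.im * (z i).im := by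
    rw [Filter.eventually_all]
    intro i
    rcases hz i with h | h
    · exact Filter.Eventually.of_forall fun _ => Or.inl h
    · have hc : Filter.Tendsto (fun d : ℝ => (z i).re + d * t.im * (z i).im)
          (nhdsWithin 0 (Set.Ioi 0)) (nhds ((z i).re + 0 * t.im * (z i).im)) :=
        (Continuous.tendsto (by fun_prop) 0).mono_left nhdsWithin_le_nhds
      filter_upwards [hc.eventually (lt_mem_nhds (a := 0) (by simpa using h))] with d hd
      exact Or.inr hd
  obtain ⟨d, hd, hd0⟩ := (h1.and self_mem_nhdsWithin).exists
  have hd0 : 0 < d := hd0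
  -- Re(u t) = Re t + d (Im t)², which is positive unless t = 0; d was chosen small enough for the
  -- other coordinates.
  let u : ℂ := ⟨1, -(d * t.im)⟩
  have hu : u ≠ 0 := fun h => by simpa [u] using congrArg Complex.re h
  have h2 := aeval_mul_of_isHomogeneous hq.homogeneous u (Fin.cons t z : Fin (n + 1) → ℂ)
  rw [h, mul_zero] at h2
  refine hq.aeval_ne_zero _ (fun i => ?_) (fun h => ?_) h2
  · refine Fin.cases ?_ (fun j => ?_) i
    · by_cases ht0 : t = 0
      · simp [ht0]
      · right
        simp only [Fin.cons_zero, Complex.mul_re, u]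
        by_cases him : t.im = 0
        · have : t.re ≠ 0 := fun hre => ht0 (Complex.ext hre him)
          simpa [him] using lt_of_le_of_ne ht this.symm
        · have : 0 < d * (t.im * t.im) := mul_pos hd0 (mul_self_pos.mpr him)
          linarith
    · rcases hd j with h | h
      · left; simp [h]
      · right
        simp only [Fin.cons_succ, Complex.mul_re, u]
        linarith
  · apply hz0
    funext i
    have := congrFun h i.succ
    simpa [hu] using this

/-- At the point (1, 0, …, 0) only the top coefficient survives, since the lower ones are forms of
positive degree in the remaining variables. -/
theorem coeff_top_pos (hq : IsHalfPlaneStable q) :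
    0 < coeff 0 ((finSuccEquiv ℝ n q).coeff (n + 1)) := by
  have h0 := hq.aeval_pos (Fin.cons 1 0)
    (fun i => by refine Fin.cases ?_ (fun j => ?_) i <;> simp) (Fin.cons_ne_zero_of_left one_ne_zero)
  rw [← eval_firstSlice, Polynomial.eval_eq_sum_range' (n := n + 2)] at h0
  · rw [Finset.sum_range_succ, Finset.sum_eq_zero] at h0
    · rw [coeff_firstSlice, aeval_isHomogeneous_zero_eq
        (hq.homogeneous.finSuccEquiv_coeff_isHomogeneous _ 0 rfl)] at h0
      simpa using h0
    · intro i hi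
      rw [Finset.mem_range] at hi
      rw [coeff_firstSlice]
      have hh := hq.homogeneous.finSuccEquiv_coeff_isHomogeneous i (n + 1 - i) (by omega)
      have := aeval_mul_of_isHomogeneous hh (0 : ℝ) 0
      simp only [Pi.zero_apply, mul_zero] at this
      rw [show (0 : Fin n → ℝ) = fun _ => 0 from rfl, this, zero_pow (by omega)]
      simp
  · refine lt_of_le_of_lt (Polynomial.natDegree_map_le) ?_
    rw [natDegree_finSuccEquiv]
    have := degreeOf_le_totalDegree q 0
    have := hq.homogeneous.totalDegree_le
    omega

theorem firstSlice_natDegree_pos {A : Type*} [CommRing A] [Algebra ℝ A] [Nontrivial A]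
    (hq : IsHalfPlaneStable q) (z : Fin n → A) : 0 < (firstSlice q z).natDegree := by
  have h : (firstSlice q z).coeff (n + 1) ≠ 0 := by
    rw [coeff_firstSlice, aeval_isHomogeneous_zero_eq
        (hq.homogeneous.finSuccEquiv_coeff_isHomogeneous _ 0 rfl)]
    have := hq.coeff_top_pos.ne'
    rwa [Ne, FaithfulSMul.algebraMap_eq_zero_iff]
  exact lt_of_lt_of_le (Nat.succ_pos n) (Polynomial.le_natDegree_of_ne_zero h)

/-- Gauss–Lucas: all roots of the slice lie in Re < 0, hence so do those of its derivative, and 0 is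
not among them. -/
theorem firstSlice_coeff_one_ne_zero (hq : IsHalfPlaneStable q) {z : Fin n → ℂ}
    (hz : ∀ i, z i = 0 ∨ 0 < (z i).re) (hz0 : z ≠ 0) : (firstSlice q z).coeff 1 ≠ 0 := by
  intro h
  have hdeg := hq.firstSlice_natDegree_pos z
  have hder : (firstSlice q z).derivative ≠ 0 := by
    intro h'
    have := Polynomial.derivative_eq_zero.mp h'
    omega
  have hmem : (0 : ℂ) ∈ (firstSlice q z).derivative.rootSet ℂ := by
    rw [Polynomial.mem_rootSet]
    refine ⟨hder, ?_⟩
    rw [Polynomial.coe_aeval_eq_eval, ← Polynomial.coeff_zero_eq_eval_zero,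
      Polynomial.coeff_derivative]
    simp [h]
  have hsub : convexHull ℝ ((firstSlice q z).rootSet ℂ) ⊆ {w : ℂ | w.re < 0} := by
    refine convexHull_min (fun w hw => ?_) (convex_halfSpace_re_lt 0)
    rw [Polynomial.mem_rootSet, Polynomial.coe_aeval_eq_eval] at hw
    by_contra hn
    exact hq.firstSlice_eval_ne_zero hz hz0 (not_lt.mp hn) hw.2
  have := hsub (Polynomial.rootSet_derivative_subset_convexHull_rootSet
    (Polynomial.natDegree_pos_iff_degree_pos.mp hdeg) hmem)
  simp at this

theorem firstSlice_root_real (hq : IsHalfPlaneStable q) {x : Fin n → ℝ}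
    (hx : ∀ i, 0 ≤ x i) (hx0 : x ≠ 0) {w : ℂ}
    (hw : (firstSlice q (fun i => (x i : ℂ))).eval w = 0) : w.re < 0 ∧ w.im = 0 := by
  have hx0' : (fun i => (x i : ℂ)) ≠ 0 := fun h => hx0 (funext fun i => by
    simpa using congrFun h i)
  have hz : ∀ i, (x i : ℂ) = 0 ∨ 0 < (x i : ℂ).re := fun i => by
    rcases (hx i).eq_or_lt with h | h
    · left; simp [← h]
    · right; simpa using h
  have hre : w.re < 0 := by
    by_contra hn
    exact hq.firstSlice_eval_ne_zero hz hx0' (not_lt.mp hn) hw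
  refine ⟨hre, ?_⟩
  by_contra him
  -- With this factor Re(u w) = (Im w)²/2 > 0 and Re u > 0, so a non-real root w would scale to a
  -- forbidden zero of the polynomial.
  let u : ℂ := ⟨w.im ^ 2 / (-2 * w.re), -w.im⟩
  have hu : u ≠ 0 := fun h => him (by simpa [u] using congrArg Complex.im h)
  have hpos : 0 < w.im ^ 2 / (-2 * w.re) := div_pos (by positivity) (by linarith)
  rw [eval_firstSlice] at hw
  have h1 := aeval_mul_of_isHomogeneous hq.homogeneous u
    (Fin.cons w (fun i => (x i : ℂ)) : Fin (n + 1) → ℂ)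
  rw [hw, mul_zero] at h1
  refine hq.aeval_ne_zero _ (fun i => ?_) (fun h => ?_) h1
  · refine Fin.cases ?_ (fun j => ?_) i
    · right
      simp only [Fin.cons_zero, Complex.mul_re, u]
      have : w.im ^ 2 / (-2 * w.re) * w.re = - w.im ^ 2 / 2 := by
        have := hre.ne
        field_simp
      rw [this]
      have : 0 < w.im ^ 2 := by positivity
      linarith
    · rcases hz j with h | h
      · left; simp only [Fin.cons_succ, h, mul_zero]
      · right
        simp only [Fin.cons_succ, Complex.mul_re, u, Complex.ofReal_im, mul_zero, sub_zero]
        exact mul_pos hpos h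
  · apply hx0'
    funext i
    have := congrFun h i.succ
    simpa [hu] using this

end IsHalfPlaneStable

-- For g = ∏ (X - r) one has g(t) = g(0) ∏ (1 + t/(-r)), and 1 + s ≤ e^s turns the product into an
-- exponential whose rate is ∑ 1/(-r) = g'(0)/g(0).
open Polynomial in
theorem eval_le_exp_of_neg_roots (s : Multiset ℝ) (hs : ∀ r ∈ s, r < 0) :
    0 < ((s.map fun r => X - C r).prod).coeff 0 ∧ 0 ≤ ((s.map fun r => X - C r).prod).coeff 1 ∧
      (s ≠ 0 → 0 < ((s.map fun r => X - C r).prod).coeff 1) ∧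
      ∀ t : ℝ, 0 ≤ t → ((s.map fun r => X - C r).prod).eval t ≤
        ((s.map fun r => X - C r).prod).coeff 0 *
          Real.exp (t * (((s.map fun r => X - C r).prod).coeff 1 /
            ((s.map fun r => X - C r).prod).coeff 0)) := by
  induction s using Multiset.induction_on with
  | empty => simp [Polynomial.coeff_one]
  | cons r s ih =>
    obtain ⟨h0, h1, -, h⟩ := ih fun a ha => hs a (Multiset.mem_cons_of_mem ha)
    have hr : 0 < -r := neg_pos.mpr (hs r (Multiset.mem_cons_self r s))
    simp only [Multiset.map_cons, Multiset.prod_cons]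
    generalize (s.map fun r => X - C r).prod = g at *
    have e0 : ((X - C r) * g).coeff 0 = -r * g.coeff 0 := by simp [sub_mul]
    have e1 : ((X - C r) * g).coeff 1 = g.coeff 0 + -r * g.coeff 1 := by
      rw [sub_mul, coeff_sub, coeff_C_mul, coeff_X_mul g 0]
      ring
    have hpos : 0 < g.coeff 0 + -r * g.coeff 1 := by
      have := mul_nonneg hr.le h1
      linarith
    rw [e0, e1]
    refine ⟨mul_pos hr h0, hpos.le, fun _ => hpos, fun t ht => ?_⟩
    have e2 : t * ((g.coeff 0 + -r * g.coeff 1) / (-r * g.coeff 0)) =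
        t / -r + t * (g.coeff 1 / g.coeff 0) := by
      have := h0.ne'
      have := hr.ne'
      generalize -r = r' at *
      field_simp
    rw [e2, Real.exp_add, eval_mul]
    have e3 : (X - C r).eval t = -r * (t / -r + 1) := by
      have := hr.ne'
      simp only [eval_sub, eval_X, eval_C]
      rw [mul_add, mul_div_cancel₀ _ this]
      ring
    rw [e3]
    have h4 := Real.add_one_le_exp (t / -r)
    have h5 : 0 ≤ t / -r + 1 := by positivity
    calc -r * (t / -r + 1) * g.eval t
        ≤ -r * (t / -r + 1) * (g.coeff 0 * Real.exp (t * (g.coeff 1 / g.coeff 0))) :=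
          mul_le_mul_of_nonneg_left (h t ht) (mul_nonneg hr.le h5)
      _ ≤ -r * Real.exp (t / -r) * (g.coeff 0 * Real.exp (t * (g.coeff 1 / g.coeff 0))) := by
          gcongr
      _ = _ := by ring

namespace IsHalfPlaneStable

open MvPolynomial

variable {n : ℕ} {q : MvPolynomial (Fin (n + 1)) ℝ}

theorem firstSlice_eval_le_exp (hq : IsHalfPlaneStable q) {x : Fin n → ℝ}
    (hx : ∀ i, 0 ≤ x i) (hx0 : x ≠ 0) :
    0 < (firstSlice q x).coeff 0 ∧ 0 < (firstSlice q x).coeff 1 ∧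
      ∀ t : ℝ, 0 ≤ t → (firstSlice q x).eval t ≤ (firstSlice q x).coeff 0 *
          Real.exp (t * ((firstSlice q x).coeff 1 / (firstSlice q x).coeff 0)) := by
  have hmap := map_firstSlice_ofReal q x
  have hdeg := hq.firstSlice_natDegree_pos x
  have hroot : ∀ w : ℂ, ((firstSlice q x).map (algebraMap ℝ ℂ)).eval w = 0 → w.re < 0 ∧ w.im = 0 :=
    fun w hw => hq.firstSlice_root_real hx hx0 (by rwa [← hmap])
  have hsplit : (firstSlice q x).Splits := by
    refine Polynomial.Splits.of_splits_map (algebraMap ℝ ℂ) (IsAlgClosed.splits _) fun w hw => ?_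
    have := hroot w (Polynomial.isRoot_of_mem_roots hw)
    exact ⟨w.re, Complex.ext (by simp) (by simp [this.2])⟩
  have hneg : ∀ r ∈ (firstSlice q x).roots, r < 0 := by
    intro r hr
    have h1 : (firstSlice q x).eval r = 0 := Polynomial.isRoot_of_mem_roots hr
    have h2 := (hroot (algebraMap ℝ ℂ r) (by rw [Polynomial.eval_map_algebraMap,
      Polynomial.aeval_algebraMap_apply, Polynomial.coe_aeval_eq_eval, h1, map_zero])).1
    simpa using h2
  have hne : (firstSlice q x).roots ≠ 0 := hsplit.roots_ne_zero hdeg.ne'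
  obtain ⟨h0, -, h1, h⟩ := eval_le_exp_of_neg_roots _ hneg
  have heq := hsplit.eq_prod_roots
  have hf0 : 0 < (firstSlice q x).coeff 0 := by
    rw [Polynomial.coeff_zero_eq_eval_zero, eval_firstSlice]
    refine hq.aeval_pos _ (fun i => ?_) (Fin.cons_ne_zero_of_right hx0)
    refine Fin.cases ?_ (fun j => ?_) i
    · simp
    · simpa using hx j
  generalize ((firstSlice q x).roots.map fun r => Polynomial.X - Polynomial.C r).prod = g at *
  generalize firstSlice q x = f at *
  have hlc : 0 < f.leadingCoeff := by
    rw [heq, Polynomial.coeff_C_mul] at hf0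
    exact pos_of_mul_pos_left hf0 h0.le
  generalize f.leadingCoeff = a at *
  subst heq
  refine ⟨hf0, ?_, fun t ht => ?_⟩
  · rw [Polynomial.coeff_C_mul]
    exact mul_pos hlc (h1 hne)
  · rw [Polynomial.coeff_C_mul, Polynomial.coeff_C_mul, Polynomial.eval_C_mul,
      mul_div_mul_left _ _ hlc.ne', mul_assoc]
    exact mul_le_mul_of_nonneg_left (h t ht) hlc.le

/-- Together with `le_aeval_coeff_one`, this is the induction step that removes one variable. -/
theorem coeff_one_finSuccEquiv {n : ℕ} {q : MvPolynomial (Fin (n + 2)) ℝ}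
    (hq : IsHalfPlaneStable q) :
    IsHalfPlaneStable ((finSuccEquiv ℝ (n + 1) q).coeff 1) where
  homogeneous := hq.homogeneous.finSuccEquiv_coeff_isHomogeneous _ _ (by omega)
  aeval_ne_zero z hz hz0 := by
    rw [← coeff_firstSlice]
    exact hq.firstSlice_coeff_one_ne_zero hz hz0
  aeval_pos x hx hx0 := by
    rw [← coeff_firstSlice]
    exact (hq.firstSlice_eval_le_exp hx hx0).2.1

/-- If f is the slice at x, then c t ∏ x_i ≤ f(t) ≤ f(0) exp(t f'(0)/f(0)). The choice t =
f(0)/f'(0) makes the exponential equal to e. -/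
theorem le_aeval_coeff_one {n : ℕ} {q : MvPolynomial (Fin (n + 2)) ℝ}
    (hq : IsHalfPlaneStable q) {c : ℝ}
    (hc : ∀ x : Fin (n + 2) → ℝ, (∀ i, 0 < x i) → c * ∏ i, x i ≤ aeval x q)
    (x : Fin (n + 1) → ℝ) (hx : ∀ i, 0 < x i) :
    c * Real.exp (-1) * ∏ i, x i ≤ aeval x ((finSuccEquiv ℝ (n + 1) q).coeff 1) := by
  have hx0 : x ≠ 0 := fun h => (hx 0).ne' (congrFun h 0)
  obtain ⟨h0, h1, h⟩ := hq.firstSlice_eval_le_exp (fun i => (hx i).le) hx0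
  have ht := div_pos h0 h1
  have h2 := h _ ht.le
  have h3 := hc (Fin.cons ((firstSlice q x).coeff 0 / (firstSlice q x).coeff 1) x)
    (fun i => by
      refine Fin.cases ?_ (fun j => ?_) i
      · simpa using ht
      · simpa using hx j)
  rw [← eval_firstSlice, Fin.prod_univ_succ] at h3
  simp only [Fin.cons_zero, Fin.cons_succ] at h3
  rw [← coeff_firstSlice]
  generalize (firstSlice q x).coeff 0 = a at *
  generalize (firstSlice q x).coeff 1 = b at *
  rw [show a / b * (b / a) = 1 by field_simp] at h2
  have h4 := h3.trans h2
  have h5 : c * (∏ i, x i) ≤ b * Real.exp 1 := by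
    have : a / b * (c * ∏ i, x i) ≤ a / b * (b * Real.exp 1) := by
      rw [show a / b * (b * Real.exp 1) = a * Real.exp 1 by field_simp]
      linarith
    exact le_of_mul_le_mul_left this ht
  rw [Real.exp_neg, mul_right_comm, ← div_eq_mul_inv, div_le_iff₀ (Real.exp_pos 1)]
  exact h5

theorem le_coeff_all_one : ∀ {n : ℕ} {q : MvPolynomial (Fin (n + 1)) ℝ},
    IsHalfPlaneStable q → ∀ {c : ℝ}, 0 ≤ c →
    (∀ x : Fin (n + 1) → ℝ, (∀ i, 0 < x i) → c * ∏ i, x i ≤ aeval x q) →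
    c * Real.exp (-(n + 1 : ℝ)) ≤ coeff (Finsupp.equivFunOnFinite.symm fun _ => 1) q
  | 0, q, hq, c, hc0, hc => by
    have h1 := hc (fun _ => 1) (fun _ => one_pos)
    have h2 : aeval (fun _ : Fin 1 => (1 : ℝ)) q =
        coeff (Finsupp.equivFunOnFinite.symm fun _ => 1) q := by
      rw [aeval_def, eval₂_eq, Finset.sum_eq_single (Finsupp.equivFunOnFinite.symm fun _ => 1)]
      · simp
      · intro d hd hne
        exfalso
        apply hne
        have := hq.homogeneous (mem_support_iff.mp hd)
        refine Finsupp.ext fun i => ?_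
        rw [Subsingleton.elim i 0]
        simpa [Finsupp.weight_apply, Finsupp.sum_fintype] using this
      · intro h
        rw [notMem_support_iff.mp h]
        simp
    rw [← h2]
    refine le_trans ?_ h1
    rw [Finset.prod_const_one]
    refine mul_le_mul_of_nonneg_left ?_ hc0
    rw [Real.exp_le_one_iff]
    norm_num
  -- Each removed variable costs one factor e. The base case could avoid its own factor, but losing
  -- it keeps the exponent uniform.
  | n + 1, q, hq, c, hc0, hc => by
    have h := le_coeff_all_one hq.coeff_one_finSuccEquiv (c := c * Real.exp (-1))
      (by positivity) (hq.le_aeval_coeff_one hc)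
    rw [finSuccEquiv_coeff_coeff, mul_assoc, ← Real.exp_add] at h
    convert h using 2
    · push_cast
      ring_nf
    · refine Finsupp.ext fun i => ?_
      refine Fin.cases ?_ (fun j => ?_) i <;> simp

end IsHalfPlaneStable

/-! ### Permanents and perfect matchings: the lower bound -/

open MvPolynomial in
theorem aeval_prod_linear {A : Type*} [CommRing A] [Algebra ℝ A] {n : ℕ}
    (M : Matrix (Fin n) (Fin n) ℝ) (z : Fin n → A) :
    aeval z (∏ i, ∑ j, C (M j i) * X j) = ∏ i, ∑ j, algebraMap ℝ A (M j i) * z j := by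
  simp

-- Expanding the product chooses a variable f i in each factor; the resulting monomial is x_1⋯x_n
-- exactly when f is a bijection.
open MvPolynomial in
theorem coeff_prod_linear {n : ℕ} (M : Matrix (Fin n) (Fin n) ℝ) :
    coeff (Finsupp.equivFunOnFinite.symm fun _ => 1) (∏ i, ∑ j, C (M j i) * X j) =
      M.permanent := by
  rw [Finset.prod_univ_sum, coeff_sum, Matrix.permanent, Fintype.piFinset_univ]
  have h : ∀ f : Fin n → Fin n, coeff (Finsupp.equivFunOnFinite.symm fun _ => 1)
      (∏ i, C (M (f i) i) * X (f i)) = if Function.Bijective f then ∏ i, M (f i) i else 0 := by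
    intro f
    rw [Finset.prod_mul_distrib, ← map_prod C, coeff_C_mul]
    have h1 : ∏ i, (X (f i) : MvPolynomial (Fin n) ℝ) =
        monomial (∑ i, Finsupp.single (f i) 1) 1 := by
      rw [monomial_sum_one]
      rfl
    rw [h1, coeff_monomial]
    have h2 : (∑ i, Finsupp.single (f i) 1 = Finsupp.equivFunOnFinite.symm fun _ : Fin n => 1) ↔
        Function.Bijective f := by
      rw [← Finite.injective_iff_bijective]
      constructor
      · intro h a b hab
        by_contra hne
        have h3 := DFunLike.congr_fun h (f a)
        rw [Finsupp.finsetSum_apply] at h3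
        have h4 : ∑ i ∈ ({a, b} : Finset (Fin n)), (Finsupp.single (f i) 1 : Fin n →₀ ℕ) (f a) ≤
            ∑ i, (Finsupp.single (f i) 1 : Fin n →₀ ℕ) (f a) :=
          Finset.sum_le_sum_of_subset (Finset.subset_univ _)
        rw [h3, Finset.sum_pair hne] at h4
        simp [hab] at h4
      · intro h
        have hb := Finite.injective_iff_bijective.mp h
        refine Finsupp.ext fun j => ?_
        obtain ⟨i, rfl⟩ := hb.2 j
        rw [Finsupp.finsetSum_apply, Finset.sum_eq_single i]
        · simp
        · intro b _ hbi
          rw [Finsupp.single_apply, if_neg (fun h' => hbi (h h'))]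
        · simp
    simp only [h2, mul_ite, mul_one, mul_zero]
  simp only [h]
  rw [← Finset.sum_filter]
  symm
  refine Finset.sum_bij (fun σ _ => ⇑σ) (fun σ _ => ?_) (fun σ _ τ _ h => DFunLike.coe_injective h)
    (fun f hf => ?_) (fun σ _ => rfl)
  · exact Finset.mem_filter.mpr ⟨Finset.mem_univ _, σ.bijective⟩
  · simp only [Finset.mem_filter, Finset.mem_univ, true_and] at hf
    exact ⟨Equiv.ofBijective f hf, Finset.mem_univ _, rfl⟩

-- A strictly positive combination of numbers that are zero or in the open right half-plane, not all
-- zero, has positive real part. A zero entry could destroy this.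
open MvPolynomial in
theorem isHalfPlaneStable_prod_linear {n : ℕ} {M : Matrix (Fin n) (Fin n) ℝ}
    (hM : ∀ i j, 0 < M i j) : IsHalfPlaneStable (∏ i, ∑ j, C (M j i) * X j) where
  homogeneous := by
    have := IsHomogeneous.prod Finset.univ (fun i => ∑ j, C (M j i) * X j) (fun _ : Fin n => 1)
      (fun i _ => IsHomogeneous.sum _ _ _ fun j _ => isHomogeneous_C_mul_X _ _)
    simpa using this
  aeval_ne_zero z hz hz0 := by
    rw [aeval_prod_linear, Finset.prod_ne_zero_iff]
    intro i _ h
    obtain ⟨j, hj⟩ := Function.ne_iff.mp hz0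
    have hnn : ∀ k, 0 ≤ (z k).re := fun k => by
      rcases hz k with h | h
      · simp [h]
      · exact h.le
    have h1 := congrArg Complex.re h
    rw [Complex.re_sum] at h1
    have h2 : 0 < ∑ k, ((algebraMap ℝ ℂ) (M k i) * z k).re := by
      refine Finset.sum_pos' (fun k _ => ?_) ⟨j, Finset.mem_univ j, ?_⟩
      · simpa using mul_nonneg (hM k i).le (hnn k)
      · have := (hz j).resolve_left hj
        simpa using mul_pos (hM j i) this
    rw [h1] at h2
    simp at h2
  aeval_pos x hx hx0 := by
    rw [aeval_prod_linear]
    obtain ⟨j, hj⟩ := Function.ne_iff.mp hx0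
    refine Finset.prod_pos fun i _ => Finset.sum_pos' (fun k _ => ?_) ⟨j, Finset.mem_univ j, ?_⟩
    · exact mul_nonneg (hM k i).le (hx k)
    · exact mul_pos (hM j i) (lt_of_le_of_ne (hx j) (Ne.symm hj))

/-- Gurvits' capacity bound for permanents, with the constant `exp (-n)`. -/
theorem exp_neg_mul_le_permanent {n : ℕ} (M : Matrix (Fin n) (Fin n) ℝ) (hM : ∀ i j, 0 ≤ M i j)
    {c : ℝ} (hc0 : 0 ≤ c)
    (hc : ∀ x : Fin n → ℝ, (∀ i, 0 < x i) → c * ∏ j, x j ≤ ∏ i, ∑ j, M j i * x j) :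
    c * Real.exp (-(n : ℝ)) ≤ M.permanent := by
  cases n with
  | zero => simpa [Matrix.permanent] using hc 0 (fun i => i.elim0)
  | succ n =>
    -- Stability needs strictly positive entries, so ε is added to each of them and then sent to 0;
    -- this only raises the capacity.
    have h1 : ∀ ε : ℝ, 0 < ε → c * Real.exp (-((n + 1 : ℕ) : ℝ)) ≤
        Matrix.permanent (Matrix.of fun i j => M i j + ε) := by
      intro ε hε
      have hst := isHalfPlaneStable_prod_linear (M := Matrix.of fun i j => M i j + ε)
        (fun i j => add_pos_of_nonneg_of_pos (hM i j) hε)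
      have := hst.le_coeff_all_one hc0 (fun x hx => by
        rw [aeval_prod_linear]
        refine (hc x hx).trans (Finset.prod_le_prod (fun i _ => Finset.sum_nonneg fun j _ =>
          mul_nonneg (hM j i) (hx j).le) fun i _ => Finset.sum_le_sum fun j _ => ?_)
        exact mul_le_mul_of_nonneg_right (by simpa [Matrix.of_apply] using hε.le) (hx j).le)
      rw [coeff_prod_linear] at this
      simpa using this
    have hcont : Continuous fun ε : ℝ => Matrix.permanent (Matrix.of fun i j => M i j + ε) := by
      simp only [Matrix.permanent, Matrix.of_apply]
      fun_prop
    have ht : Filter.Tendsto (fun ε : ℝ => Matrix.permanent (Matrix.of fun i j => M i j + ε))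
        (nhdsWithin 0 (Set.Ioi 0)) (nhds M.permanent) := by
      have := (hcont.tendsto 0).mono_left (nhdsWithin_le_nhds (s := Set.Ioi 0))
      simp only [add_zero] at this
      exact this
    exact ge_of_tendsto ht (Filter.eventually_of_mem self_mem_nhdsWithin fun ε hε => h1 ε hε)

/-- A doubly stochastic matrix of order `n` has permanent at least `exp (-n)`. -/
theorem exp_neg_le_permanent_of_doublyStochastic {n : ℕ} (M : Matrix (Fin n) (Fin n) ℝ)
    (hM : M ∈ doublyStochastic ℝ (Fin n)) : Real.exp (-(n : ℝ)) ≤ M.permanent := by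
  rw [mem_doublyStochastic_iff_sum] at hM
  obtain ⟨h0, hrow, hcol⟩ := hM
  have := exp_neg_mul_le_permanent M h0 (c := 1) zero_le_one (fun x hx => ?_)
  · simpa using this
  rw [one_mul]
  -- The capacity is at least 1: row sums split each x j into powers, and column sums serve as the
  -- weights in the AM-GM inequality.
  calc ∏ j, x j = ∏ j, ∏ i, x j ^ M j i := by
        refine Finset.prod_congr rfl fun j _ => ?_
        rw [← Real.rpow_sum_of_pos (hx j), hrow j, Real.rpow_one]
    _ = ∏ i, ∏ j, x j ^ M j i := Finset.prod_comm
    _ ≤ ∏ i, ∑ j, M j i * x j := by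
        refine Finset.prod_le_prod (fun i _ => Finset.prod_nonneg fun j _ =>
          Real.rpow_nonneg (hx j).le _) fun i _ => ?_
        exact Real.geom_mean_le_arith_mean_weighted _ _ _ (fun j _ => h0 j i) (hcol i)
          (fun j _ => (hx j).le)

/-- The number of perfect matchings of a `d`-regular bipartite graph is at least `(d / e) ^ n`. -/
theorem pow_div_exp_le_card_matchings {n d : ℕ} (S : Fin n → Finset (Fin n))
    (hrow : ∀ i, (S i).card = d) (hcol : ∀ k, (Finset.univ.filter fun i => k ∈ S i).card = d) :
    (d : ℝ) ^ n * Real.exp (-(n : ℝ)) ≤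
      (Finset.univ.filter fun σ : Equiv.Perm (Fin n) => ∀ i, σ i ∈ S i).card := by
  rcases Nat.eq_zero_or_pos d with rfl | hd
  · rcases Nat.eq_zero_or_pos n with rfl | hn
    · simp
    · rw [Nat.cast_zero, zero_pow hn.ne', zero_mul]
      positivity
  have hd' : (0 : ℝ) < d := Nat.cast_pos.mpr hd
  have h := exp_neg_le_permanent_of_doublyStochastic
    (Matrix.of fun k i => if k ∈ S i then (d : ℝ)⁻¹ else 0) (by
      rw [mem_doublyStochastic_iff_sum]
      simp only [Matrix.of_apply]
      refine ⟨fun k i => ?_, fun k => ?_, fun i => ?_⟩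
      · split_ifs <;> positivity
      · rw [← Finset.sum_filter, Finset.sum_const, hcol, nsmul_eq_mul, mul_inv_cancel₀ hd'.ne']
      · rw [← Finset.sum_filter, Finset.filter_univ_mem, Finset.sum_const, hrow, nsmul_eq_mul,
          mul_inv_cancel₀ hd'.ne'])
  have h2 : Matrix.permanent
      (Matrix.of fun k i => if k ∈ S i then (d : ℝ)⁻¹ else 0) =
      (Finset.univ.filter fun σ : Equiv.Perm (Fin n) => ∀ i, σ i ∈ S i).card * ((d : ℝ) ^ n)⁻¹ := by
    simp only [Matrix.permanent, Matrix.of_apply, Finset.prod_ite_zero, Finset.mem_univ, true_imp_iff]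
    rw [← Finset.sum_filter, Finset.sum_const, nsmul_eq_mul]
    simp
  rw [h2, ← div_eq_mul_inv, le_div_iff₀ (pow_pos hd' n)] at h
  linarith

/-! ### Brègman's theorem -/

open Classical in
/-- The bijections `e` with `e i ∈ S i` for all `i`. -/
noncomputable def matchings {ι α : Type} [Fintype ι] [Fintype α] (S : ι → Finset α) :
    Finset (ι ≃ α) :=
  Finset.univ.filter fun e => ∀ i, e i ∈ S i

theorem mem_matchings {ι α : Type} [Fintype ι] [Fintype α] {S : ι → Finset α} {e : ι ≃ α} :
    e ∈ matchings S ↔ ∀ i, e i ∈ S i := by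
  simp [matchings]

/-- The logarithm of the contribution `(d!)^(1/d)` of a vertex of degree `d` to Brègman's bound. -/
noncomputable def bregmanLog (d : ℕ) : ℝ := Real.log d.factorial / d

theorem mul_bregmanLog (d : ℕ) : d * bregmanLog d = Real.log d.factorial := by
  rcases Nat.eq_zero_or_pos d with rfl | hd
  · simp
  · have : (d : ℝ) ≠ 0 := by positivity
    rw [bregmanLog, mul_div_cancel₀ _ this]

theorem log_add_mul_bregmanLog_pred {d : ℕ} (hd : 0 < d) :
    Real.log d + (d - 1 : ℕ) * bregmanLog (d - 1) = d * bregmanLog d := by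
  rw [mul_bregmanLog, mul_bregmanLog, ← Nat.mul_factorial_pred hd.ne', Nat.cast_mul,
    Real.log_mul (by positivity) (by positivity)]

/-- Jensen's inequality for x log x, obtained termwise from log y ≤ y - 1; terms with f k = 0
vanish. -/
theorem mul_log_sum_le {α : Type*} (s : Finset α) (f : α → ℕ) :
    ((∑ k ∈ s, f k : ℕ) : ℝ) * Real.log (∑ k ∈ s, f k : ℕ) ≤
      ((∑ k ∈ s, f k : ℕ) : ℝ) * Real.log s.card + ∑ k ∈ s, (f k : ℝ) * Real.log (f k) := by
  rcases Nat.eq_zero_or_pos (∑ k ∈ s, f k) with h0 | hpos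
  · rw [h0]
    simp only [Nat.cast_zero, zero_mul, zero_add]
    exact Finset.sum_nonneg fun k _ => mul_nonneg (by positivity) (Real.log_natCast_nonneg _)
  set N := ∑ k ∈ s, f k with hN
  have hs : 0 < s.card := by
    rw [Finset.card_pos]
    by_contra h
    rw [Finset.not_nonempty_iff_eq_empty] at h
    simp [h] at hN
    omega
  have hs' : (0 : ℝ) < s.card := by positivity
  have hN' : (0 : ℝ) < N := by positivity
  have key : ∀ k ∈ s, (f k : ℝ) * (Real.log N - Real.log s.card - Real.log (f k)) ≤
      N / s.card - f k := by
    intro k _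
    rcases Nat.eq_zero_or_pos (f k) with h | h
    · rw [h]
      simp only [Nat.cast_zero, zero_mul, sub_zero]
      positivity
    · have hk : (0 : ℝ) < f k := by positivity
      rw [← Real.log_div hN'.ne' hs'.ne', ← Real.log_div (by positivity) hk.ne']
      have := Real.log_le_sub_one_of_pos (x := N / s.card / f k) (by positivity)
      calc (f k : ℝ) * Real.log (N / s.card / f k) ≤ f k * (N / s.card / f k - 1) :=
            mul_le_mul_of_nonneg_left this hk.le
        _ = _ := by field_simp
  have h1 := Finset.sum_le_sum key
  have h2 : ∑ k ∈ s, (f k : ℝ) = N := by rw [hN]; push_cast; rfl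
  have h3 : ∑ k ∈ s, ((N : ℝ) / s.card - f k) = 0 := by
    rw [Finset.sum_sub_distrib, h2, Finset.sum_const, nsmul_eq_mul]
    field_simp
    ring
  have h4 : ∑ k ∈ s, (f k : ℝ) * (Real.log N - Real.log s.card - Real.log (f k)) =
      N * (Real.log N - Real.log s.card) - ∑ k ∈ s, (f k : ℝ) * Real.log (f k) := by
    rw [← h2, Finset.sum_mul, ← Finset.sum_sub_distrib]
    exact Finset.sum_congr rfl fun k _ => by ring
  rw [h3, h4] at h1
  linarith

open Classical in
theorem card_matchings_filter_le {ι α : Type} [Fintype ι] [Fintype α] (S : ι → Finset α)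
    (i : ι) (k : α) :
    ((matchings S).filter fun e => e i = k).card ≤
      (matchings fun j : {j // j ≠ i} => (S j).subtype (· ≠ k)).card := by
  rw [← Fintype.card_coe, ← Fintype.card_coe]
  have h : ∀ e : {e // e ∈ (matchings S).filter fun e => e i = k}, ∀ j, j ≠ i ↔ e.1 j ≠ k := by
    intro e j
    have h0 : e.1 i = k := (Finset.mem_filter.mp e.2).2
    rw [Ne, Ne, ← e.1.injective.eq_iff (a := j) (b := i), h0]
  refine Fintype.card_le_of_injective (fun e => ⟨e.1.subtypeEquiv (h e), ?_⟩) ?_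
  · rw [mem_matchings]
    intro j
    rw [Finset.mem_subtype]
    exact mem_matchings.mp (Finset.mem_filter.mp e.2).1 j
  · intro e e' hee
    apply Subtype.ext
    ext j
    by_cases hj : j = i
    · rw [hj, (Finset.mem_filter.mp e.2).2, (Finset.mem_filter.mp e'.2).2]
    · have := DFunLike.congr_fun (congrArg Subtype.val hee) ⟨j, hj⟩
      exact congrArg Subtype.val this

-- This is the bookkeeping that closes the induction in Brègman's theorem. As i varies, e i runs
-- over all symbols except e j: of these d - 1 lie in S j and lower its degree d, and the other n -
-- d leave it unchanged. The factorial recursion d! = d (d-1)! then absorbs log d.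
open Classical in
theorem sum_bregmanLog_erase {ι α : Type} [Fintype ι] [Fintype α] {S : ι → Finset α} {e : ι ≃ α}
    (he : e ∈ matchings S) (j : ι) :
    Real.log (S j).card + ∑ i ∈ Finset.univ.erase j, bregmanLog ((S j).erase (e i)).card =
      Fintype.card ι * bregmanLog (S j).card := by
  have hj := mem_matchings.mp he j
  have hd : 0 < (S j).card := Finset.card_pos.mpr ⟨_, hj⟩
  have h1 : ∑ i ∈ Finset.univ.erase j, bregmanLog ((S j).erase (e i)).card =
      ∑ k ∈ Finset.univ.erase (e j), bregmanLog ((S j).erase k).card := by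
    refine Finset.sum_equiv e (fun i => ?_) fun i _ => rfl
    simp
  have h2 : (Finset.univ : Finset α).erase (e j) = (S j).erase (e j) ∪ (S j)ᶜ := by
    ext k
    by_cases hk : k ∈ S j
    · simp [hk]
    · have : k ≠ e j := fun h => hk (h ▸ hj)
      simp [hk, this]
  have h3 : Disjoint ((S j).erase (e j)) (S j)ᶜ :=
    Finset.disjoint_of_subset_left (Finset.erase_subset _ _) disjoint_compl_right
  have hcard : Fintype.card ι = Fintype.card α := Fintype.card_congr e
  rw [h1, h2, Finset.sum_union h3, Finset.sum_congr rfl (g := fun _ => bregmanLog ((S j).card - 1))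
    (fun k hk => by rw [Finset.card_erase_of_mem (Finset.mem_of_mem_erase hk)]),
    Finset.sum_congr (s₁ := (S j)ᶜ) rfl (g := fun _ => bregmanLog (S j).card)
    (fun k hk => by rw [Finset.erase_eq_of_notMem (Finset.mem_compl.mp hk)]),
    Finset.sum_const, Finset.sum_const, nsmul_eq_mul, nsmul_eq_mul, ← add_assoc,
    Finset.card_erase_of_mem hj, log_add_mul_bregmanLog_pred hd, Finset.card_compl, hcard,
    Nat.cast_sub (Finset.card_le_univ _)]
  ring

open Classical in
/-- Brègman's theorem. -/
theorem log_card_matchings_le : ∀ (n : ℕ) {ι α : Type} [Fintype ι] [Fintype α] (S : ι → Finset α),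
    Fintype.card ι = n → (matchings S).Nonempty →
    Real.log (matchings S).card ≤ ∑ i, bregmanLog (S i).card
  | 0, ι, α, _, _, S, hι, _ => by
    have : IsEmpty ι := Fintype.card_eq_zero_iff.mp hι
    have h : (matchings S).card ≤ 1 :=
      Finset.card_le_one.mpr fun a _ b _ => Equiv.ext fun i => isEmptyElim i
    have h' : Real.log (matchings S).card ≤ 0 :=
      Real.log_nonpos (by positivity) (by exact_mod_cast h)
    simpa using h'
  | n + 1, ι, α, _, _, S, hι, hne => by
    set M := matchings S with hM
    have hNpos : (0 : ℝ) < M.card := by exact_mod_cast Finset.card_pos.mpr hne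
    -- Schrijver's argument: the matchings are split by their value at i, Jensen's inequality is
    -- applied, and the result is rewritten as a sum over matchings.
    have h1 : ∀ i, (M.card : ℝ) * Real.log M.card ≤
        ∑ e ∈ M, (Real.log (S i).card + Real.log (M.filter fun e' => e' i = e i).card) := by
      intro i
      have hmaps : ∀ e ∈ M, e i ∈ S i := fun e he => mem_matchings.mp he i
      have hc := Finset.card_eq_sum_card_fiberwise hmaps
      have h := mul_log_sum_le (S i) fun k => (M.filter fun e => e i = k).card
      rw [← hc] at h
      refine h.trans (le_of_eq ?_)
      rw [Finset.sum_add_distrib, Finset.sum_const, nsmul_eq_mul,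
        ← Finset.sum_fiberwise_of_maps_to hmaps
          (fun e => Real.log (M.filter fun e' => e' i = e i).card)]
      congr 1
      refine Finset.sum_congr rfl fun k _ => ?_
      rw [Finset.sum_congr rfl (g := fun _ => Real.log (M.filter fun e' => e' i = k).card)
        (fun e he => by rw [(Finset.mem_filter.mp he).2]), Finset.sum_const, nsmul_eq_mul]
    have h2 : ∀ e ∈ M, ∀ i, Real.log (M.filter fun e' => e' i = e i).card ≤
        ∑ j ∈ Finset.univ.erase i, bregmanLog ((S j).erase (e i)).card := by
      intro e he i
      have hle := card_matchings_filter_le S i (e i)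
      have hpos : 0 < (M.filter fun e' => e' i = e i).card :=
        Finset.card_pos.mpr ⟨e, Finset.mem_filter.mpr ⟨he, rfl⟩⟩
      have hcard : Fintype.card {j // j ≠ i} = n := by
        rw [Fintype.card_subtype_compl, hι]
        simp
      have hih := log_card_matchings_le n (fun j : {j // j ≠ i} => (S j).subtype (· ≠ e i)) hcard
        (Finset.card_pos.mp (hpos.trans_le hle))
      have hlog : Real.log (M.filter fun e' => e' i = e i).card ≤
          Real.log (matchings fun j : {j // j ≠ i} => (S j).subtype (· ≠ e i)).card :=
        Real.log_le_log (by exact_mod_cast hpos) (by exact_mod_cast hle)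
      refine (hlog.trans hih).trans (le_of_eq ?_)
      rw [Finset.sum_subtype (Finset.univ.erase i) (p := fun j => j ≠ i) (by simp)]
      refine Finset.sum_congr rfl fun j _ => ?_
      rw [Finset.card_subtype, Finset.filter_ne']
    have h3 : ∀ e ∈ M, ∑ i, (Real.log (S i).card + Real.log (M.filter fun e' => e' i = e i).card) ≤
        Fintype.card ι * ∑ j, bregmanLog (S j).card := by
      intro e he
      refine (Finset.sum_le_sum fun i _ => add_le_add_right (h2 e he i) _).trans (le_of_eq ?_)
      rw [Finset.sum_add_distrib, Finset.mul_sum]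
      rw [Finset.sum_comm' (t' := Finset.univ) (s' := fun j => Finset.univ.erase j)
        (by simp [ne_comm]), ← Finset.sum_add_distrib]
      exact Finset.sum_congr rfl fun j _ => sum_bregmanLog_erase he j
    -- Summing over every i, rather than expanding along one, makes the bound exact for each
    -- matching separately; the common factor |ι| |M| is cancelled at the end.
    have h4 := Finset.sum_le_sum fun i (_ : i ∈ Finset.univ) => h1 i
    rw [Finset.sum_comm] at h4
    have h5 := h4.trans (Finset.sum_le_sum h3)
    simp only [Finset.sum_const, nsmul_eq_mul, Finset.card_univ] at h5
    have hn : (0 : ℝ) < Fintype.card ι := by rw [hι]; positivity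
    rw [mul_left_comm] at h5
    exact le_of_mul_le_mul_left (le_of_mul_le_mul_left h5 hNpos) hn

/-! ### Counting Latin rectangles row by row -/

open Classical in
/-- The `m × n` Latin rectangles, as sequences of `m` permutations, whose entry in row `r` and
column `j` lies in `B r j`. -/
noncomputable def latinRectangles {n : ℕ} (B : ℕ → Fin n → Finset (Fin n)) (m : ℕ) :
    Finset (Fin m → Equiv.Perm (Fin n)) :=
  Finset.univ.filter fun f =>
    (∀ (r : Fin m) (j : Fin n), f r j ∈ B r j) ∧ ∀ j, Function.Injective fun r => f r j

theorem mem_latinRectangles {n : ℕ} {B : ℕ → Fin n → Finset (Fin n)} {m : ℕ}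
    {f : Fin m → Equiv.Perm (Fin n)} :
    f ∈ latinRectangles B m ↔ (∀ (r : Fin m) (j : Fin n), f r j ∈ B r j) ∧ ∀ j, Function.Injective fun r => f r j := by
  simp [latinRectangles]

/-- The symbols that a new row, appended to the rectangle `f`, may carry in column `j`. -/
def availableSymbols {n : ℕ} (B : ℕ → Fin n → Finset (Fin n)) {m : ℕ}
    (f : Fin m → Equiv.Perm (Fin n)) (j : Fin n) : Finset (Fin n) :=
  B m j \ Finset.univ.image fun r => f r j

theorem snoc_mem_latinRectangles {n : ℕ} {B : ℕ → Fin n → Finset (Fin n)} {m : ℕ}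
    {f : Fin m → Equiv.Perm (Fin n)} {σ : Equiv.Perm (Fin n)} :
    (Fin.snoc f σ : Fin (m + 1) → Equiv.Perm (Fin n)) ∈ latinRectangles B (m + 1) ↔
      f ∈ latinRectangles B m ∧ σ ∈ matchings (availableSymbols B f) := by
  rw [mem_latinRectangles, mem_latinRectangles, mem_matchings]
  have h : ∀ j, (fun r => (Fin.snoc f σ : Fin (m + 1) → Equiv.Perm (Fin n)) r j) =
      Fin.snoc (fun r => f r j) (σ j) := by
    intro j
    funext r
    refine Fin.lastCases ?_ (fun r => ?_) r <;> simp
  simp only [h, Fin.snoc_injective_iff, Fin.forall_fin_succ', Fin.snoc_castSucc, Fin.snoc_last,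
    availableSymbols, Finset.mem_sdiff, Finset.mem_image, Finset.mem_univ, true_and,
    Set.mem_range, Fin.val_castSucc, Fin.val_last]
  grind

open Classical in
theorem card_latinRectangles_succ {n : ℕ} (B : ℕ → Fin n → Finset (Fin n)) (m : ℕ) :
    (latinRectangles B (m + 1)).card =
      ∑ f ∈ latinRectangles B m, (matchings (availableSymbols B f)).card := by
  rw [← Finset.card_sigma]
  symm
  refine Finset.card_bij (fun p _ => (Fin.snoc p.1 p.2 : Fin (m + 1) → Equiv.Perm (Fin n)))
    (fun p hp => snoc_mem_latinRectangles.mpr (Finset.mem_sigma.mp hp)) (fun p _ q _ h => ?_)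
    (fun g hg => ?_)
  · obtain ⟨p1, p2⟩ := p
    obtain ⟨q1, q2⟩ := q
    obtain ⟨h1, h2⟩ := Fin.snoc_inj.mp h
    simp only at h1 h2
    rw [h1, h2]
  · refine ⟨⟨Fin.init g, g (Fin.last m)⟩, ?_, Fin.snoc_init_self g⟩
    rw [Finset.mem_sigma]
    apply snoc_mem_latinRectangles.mp
    rwa [Fin.snoc_init_self]

/-- Since the allowed sets grow with the row, all m symbols already used in the column are allowed
in the new cell, so the count does not depend on the rectangle. This is what makes the row-by-row
product bound possible. -/
theorem card_availableSymbols {n : ℕ} {B : ℕ → Fin n → Finset (Fin n)} {m : ℕ}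
    {f : Fin m → Equiv.Perm (Fin n)} (hf : f ∈ latinRectangles B m) {j : Fin n}
    (hB : ∀ r < m, B r j ⊆ B m j) : (availableSymbols B f j).card = (B m j).card - m := by
  rw [mem_latinRectangles] at hf
  rw [availableSymbols, Finset.card_sdiff_of_subset, Finset.card_image_of_injective _ (hf.2 j)]
  · simp
  · intro k hk
    obtain ⟨r, -, rfl⟩ := Finset.mem_image.mp hk
    exact hB r r.2 (hf.1 r j)

theorem pow_mul_exp_le_card_latinRectangles (n : ℕ) : ∀ m ≤ n,
    ((∏ r ∈ Finset.range m, (n - r) : ℕ) : ℝ) ^ n * Real.exp (-(n * m : ℝ)) ≤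
      (latinRectangles (fun _ _ => (Finset.univ : Finset (Fin n))) m).card
  | 0, _ => by
    have : (latinRectangles (fun _ _ => (Finset.univ : Finset (Fin n))) 0).Nonempty :=
      ⟨fun r => r.elim0, mem_latinRectangles.mpr ⟨fun r => r.elim0, fun j r => r.elim0⟩⟩
    have : 1 ≤ (latinRectangles (fun _ _ => (Finset.univ : Finset (Fin n))) 0).card :=
      Finset.card_pos.mpr this
    simpa using this
  | m + 1, hm => by
    classical
    have ih := pow_mul_exp_le_card_latinRectangles n m (by omega)
    have hstep : ∀ f ∈ latinRectangles (fun _ _ => (Finset.univ : Finset (Fin n))) m,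
        ((n - m : ℕ) : ℝ) ^ n * Real.exp (-(n : ℝ)) ≤
          (matchings (availableSymbols (fun _ _ => (Finset.univ : Finset (Fin n))) f)).card := by
      intro f hf
      have h := pow_div_exp_le_card_matchings (d := n - m)
        (availableSymbols (fun _ _ => (Finset.univ : Finset (Fin n))) f)
        (fun j => by rw [card_availableSymbols hf (fun _ _ => subset_rfl)]; simp)
        (fun k => by
          have hf' := (mem_latinRectangles.mp hf).2
          -- The columns closed to k are those where k already occurs, one in each of the m rows and
          -- all distinct, which gives regularity on the symbol side.
          have h1 : (Finset.univ.filter fun j => k ∈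
              availableSymbols (fun _ _ => (Finset.univ : Finset (Fin n))) f j) =
              (Finset.univ.image fun r => (f r).symm k)ᶜ := by
            ext j
            simp only [availableSymbols, Finset.mem_filter, Finset.mem_univ, true_and,
              Finset.mem_sdiff, Finset.mem_image, Finset.mem_compl, Equiv.symm_apply_eq,
              eq_comm (a := k)]
          rw [h1, Finset.card_compl, Finset.card_image_of_injective]
          · simp
          · intro r s hrs
            simp only at hrs
            apply hf' ((f r).symm k)
            simp only [Equiv.apply_symm_apply]
            rw [hrs, Equiv.apply_symm_apply])
      convert h using 2
      exact congrArg Finset.card (by ext; simp [mem_matchings])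
    rw [card_latinRectangles_succ, Nat.cast_sum]
    refine le_trans ?_ (Finset.sum_le_sum hstep)
    rw [Finset.sum_const, nsmul_eq_mul, Finset.prod_range_succ, Nat.cast_mul, mul_pow,
      show (-(n * (m + 1 : ℕ) : ℝ)) = -(n * m : ℝ) + -(n : ℝ) by push_cast; ring, Real.exp_add]
    calc _ = (((∏ r ∈ Finset.range m, (n - r) : ℕ) : ℝ) ^ n * Real.exp (-(n * m : ℝ))) *
          (((n - m : ℕ) : ℝ) ^ n * Real.exp (-(n : ℝ))) := by ring
      _ ≤ _ := mul_le_mul_of_nonneg_right ih (by positivity)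

/-- Brègman's theorem is applied to each new row. The first conjunct ensures that the truncated
subtraction in the bound is a genuine positive degree. -/
theorem log_card_latinRectangles_le {n : ℕ} {B : ℕ → Fin n → Finset (Fin n)}
    (hB : ∀ m j, ∀ r < m, B r j ⊆ B m j) : ∀ m : ℕ, (latinRectangles B m).Nonempty →
    (∀ r < m, ∀ j, r < (B r j).card) ∧ Real.log (latinRectangles B m).card ≤
      ∑ r ∈ Finset.range m, ∑ j, bregmanLog ((B r j).card - r)
  | 0, _ => by
    have h : (latinRectangles B 0).card ≤ 1 :=
      Finset.card_le_one.mpr fun a _ b _ => funext fun i => i.elim0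
    have h' : Real.log (latinRectangles B 0).card ≤ 0 :=
      Real.log_nonpos (by positivity) (by exact_mod_cast h)
    simpa using h'
  | m + 1, hne => by
    have hpos := Finset.card_pos.mpr hne
    have hcard := card_latinRectangles_succ B m
    obtain ⟨f, hf, hM⟩ : ∃ f ∈ latinRectangles B m,
        (matchings (availableSymbols B f)).card ≠ 0 :=
      Finset.exists_ne_zero_of_sum_ne_zero (by omega)
    obtain ⟨ih1, ih2⟩ := log_card_latinRectangles_le hB m ⟨f, hf⟩
    refine ⟨fun r hr j => ?_, ?_⟩
    · rcases Nat.lt_succ_iff_lt_or_eq.mp hr with h | rfl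
      · exact ih1 r h j
      · obtain ⟨σ, hσ⟩ := Finset.card_ne_zero.mp hM
        have h1 := Finset.card_pos.mpr ⟨_, mem_matchings.mp hσ j⟩
        rw [card_availableSymbols hf (hB r j)] at h1
        omega
    · have hstep : ∀ g ∈ latinRectangles B m, ((matchings (availableSymbols B g)).card : ℝ) ≤
          Real.exp (∑ j, bregmanLog ((B m j).card - m)) := by
        intro g hg
        rcases (matchings (availableSymbols B g)).eq_empty_or_nonempty with h0 | h0
        · rw [h0]
          simpa using (Real.exp_pos _).le
        · have h1 := log_card_matchings_le n _ (Fintype.card_fin n) h0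
          rw [Real.log_le_iff_le_exp (by exact_mod_cast Finset.card_pos.mpr h0)] at h1
          simpa only [card_availableSymbols hg (hB m _)] using h1
      have hle : ((latinRectangles B (m + 1)).card : ℝ) ≤ (latinRectangles B m).card *
          Real.exp (∑ j, bregmanLog ((B m j).card - m)) := by
        rw [hcard, Nat.cast_sum]
        refine (Finset.sum_le_sum hstep).trans (le_of_eq ?_)
        rw [Finset.sum_const, nsmul_eq_mul]
      have hpos' : (0 : ℝ) < (latinRectangles B m).card := by
        exact_mod_cast Finset.card_pos.mpr ⟨f, hf⟩
      refine (Real.log_le_log (by exact_mod_cast hpos) hle).trans ?_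
      rw [Real.log_mul hpos'.ne' (Real.exp_pos _).ne', Real.log_exp, Finset.sum_range_succ]
      linarith

theorem pow_mul_exp_le_card_latinSquares (n : ℕ) :
    (n.factorial : ℝ) ^ n * Real.exp (-(n * n : ℝ)) ≤ (latinSquares n).card := by
  have h := pow_mul_exp_le_card_latinRectangles n n le_rfl
  rw [← Nat.descFactorial_eq_prod_range, Nat.descFactorial_self] at h
  refine h.trans (Nat.cast_le.mpr ?_)
  refine Finset.card_le_card_of_injOn (fun f i j => f i j) (fun f hf => ?_) (fun f _ g _ h => ?_)
  · have hf := (mem_latinRectangles.mp hf).2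
    simp only [latinSquares, Finset.coe_filter, Finset.mem_univ, true_and, Set.mem_ofPred_eq]
    exact ⟨fun i => (f i).bijective, fun j => Finite.injective_iff_bijective.mp (hf j)⟩
  · funext i
    exact Equiv.ext fun j => congrFun (congrFun h i) j

/-! ### Latin squares with a prescribed empty box: the upper bound -/

theorem exists_perm_mem_iff {n : ℕ} (X : Finset (Fin n)) :
    ∃ π : Equiv.Perm (Fin n), ∀ r, π r ∈ X ↔ (r : ℕ) < X.card := by
  classical
  have hX : X.card ≤ n := by simpa using Finset.card_le_univ X
  have e : {r : Fin n // (r : ℕ) < X.card} ≃ {r // r ∈ X} := by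
    refine Fintype.equivOfCardEq ?_
    rw [Fintype.card_coe, Fintype.card_subtype, Fin.card_filter_val_lt, min_eq_right hX]
  refine ⟨e.extendSubtype, fun r => ⟨fun h => ?_, fun h => e.extendSubtype_mem r h⟩⟩
  by_contra hr
  exact e.extendSubtype_not_mem r hr h

/-- The symbols allowed in row `r` and column `j` when the box formed by the first `x` rows, the
columns in `Y` and the symbols in `Z` has to be empty. -/
def boxAllowedSymbols {n : ℕ} (x : ℕ) (Y Z : Finset (Fin n)) (r : ℕ) (j : Fin n) :
    Finset (Fin n) :=
  if r < x ∧ j ∈ Y then Zᶜ else Finset.univ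

-- Permuting rows moves X to the top. The restricted rows then come first, so the allowed sets
-- increase down each column.
open Classical in
theorem card_filter_isEmptyBox_le {n : ℕ} (X Y Z : Finset (Fin n)) :
    ((latinSquares n).filter fun L => IsEmptyBox L X Y Z).card ≤
      (latinRectangles (boxAllowedSymbols X.card Y Z) n).card := by
  obtain ⟨π, hπ⟩ := exists_perm_mem_iff X
  rw [← Fintype.card_coe, ← Fintype.card_coe]
  have hL : ∀ L : {L // L ∈ (latinSquares n).filter fun L => IsEmptyBox L X Y Z},
      IsLatinSquare L.1 ∧ ∀ i ∈ X, ∀ j ∈ Y, L.1 i j ∉ Z := by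
    intro L
    obtain ⟨h1, h2⟩ := Finset.mem_filter.mp L.2
    refine ⟨(Finset.mem_filter.mp h1).2, fun i hi j hj hk => ?_⟩
    rw [IsEmptyBox, boxCount, Finset.card_eq_zero, Finset.filter_eq_empty_iff] at h2
    exact h2 (x := (i, j, L.1 i j)) (by simp [hi, hj, hk]) rfl
  refine Fintype.card_le_of_injective
    (fun L => ⟨fun r => Equiv.ofBijective _ ((hL L).1.1 (π r)), ?_⟩) ?_
  · rw [mem_latinRectangles]
    refine ⟨fun r j => ?_, fun j => ?_⟩
    · rw [boxAllowedSymbols]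
      split_ifs with h
      · rw [Finset.mem_compl]
        exact (hL L).2 _ ((hπ r).mpr h.1) j h.2
      · exact Finset.mem_univ _
    · exact ((hL L).1.2 j).1.comp π.injective
  · intro L L' h
    apply Subtype.ext
    funext i j
    have h1 := congrFun (congrArg Subtype.val h) (π.symm i)
    have h2 := DFunLike.congr_fun h1 j
    simpa using h2

theorem log_factorial_le : ∀ {d : ℕ}, 0 < d →
    Real.log d.factorial ≤ d * Real.log d - d + Real.log d + 1
  | 1, _ => by simp
  | d + 2, _ => by
    have ih := log_factorial_le (Nat.succ_pos d)
    have h1 : (0 : ℝ) < (d + 1 : ℕ) := by positivity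
    have h2 : (0 : ℝ) < (d + 2 : ℕ) := by positivity
    rw [Nat.factorial_succ, Nat.cast_mul, Real.log_mul h2.ne' (by positivity)]
    have h3 := Real.log_le_sub_one_of_pos (div_pos h1 h2)
    rw [Real.log_div h1.ne' h2.ne'] at h3
    have h4 : ((d + 2 : ℕ) : ℝ) * (((d + 1 : ℕ) : ℝ) / (d + 2 : ℕ) - 1) = -1 := by
      rw [mul_sub, mul_div_cancel₀ _ h2.ne']
      push_cast
      ring
    have h5 := mul_le_mul_of_nonneg_left h3 h2.le
    rw [h4] at h5
    have h6 : ((d + 2 : ℕ) : ℝ) = (d + 1 : ℕ) + 1 := by push_cast; ring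
    generalize Real.log (d + 2 : ℕ) = a at *
    generalize Real.log (d + 1 : ℕ) = b at *
    rw [show d + 1 + 1 = d + 2 from rfl]
    rw [h6] at *
    linarith

/-- The Stirling-type bound divided by d. Its error keeps log n in place of log d, so that only 1/d
has to be summed. -/
theorem bregmanLog_le {d n : ℕ} (hd : 0 < d) (hdn : d ≤ n) :
    bregmanLog d ≤ Real.log d - 1 + (Real.log n + 1) * (d : ℝ)⁻¹ := by
  have hd' : (0 : ℝ) < d := by positivity
  have h1 := log_factorial_le hd
  have h2 : Real.log d ≤ Real.log n := Real.log_le_log hd' (by exact_mod_cast hdn)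
  rw [bregmanLog, div_le_iff₀ hd']
  have : (Real.log d - 1 + (Real.log n + 1) * (d : ℝ)⁻¹) * d =
      d * Real.log d - d + (Real.log n + 1) := by field_simp
  rw [this]
  linarith

/-- From log(1 - z/d) ≤ -z/d ≤ -z/n. With z = |Z| this is the saving at one cell of the box, uniform
over rows. -/
theorem log_sub_le {d z n : ℕ} (hd : z < d) (hdn : d ≤ n) :
    Real.log (d - z : ℕ) ≤ Real.log d - z / n := by
  have h1 : (0 : ℝ) < (d - z : ℕ) := by exact_mod_cast Nat.sub_pos_of_lt hd
  have h2 : (0 : ℝ) < d := by exact_mod_cast (Nat.zero_le z).trans_lt hd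
  have h3 := Real.log_le_sub_one_of_pos (div_pos h1 h2)
  rw [Real.log_div h1.ne' h2.ne', Nat.cast_sub hd.le, sub_div, div_self h2.ne'] at h3
  have h4 : (z : ℝ) / n ≤ z / d := by gcongr
  rw [Nat.cast_sub hd.le]
  linarith

theorem sum_range_inv_sub_le (N : ℕ) :
    ∑ r ∈ Finset.range N, ((N - r : ℕ) : ℝ)⁻¹ ≤ 1 + Real.log N := by
  have h := harmonic_le_one_add_log N
  rw [harmonic, ← Finset.sum_range_reflect] at h
  push_cast at h
  refine le_trans (le_of_eq (Finset.sum_congr rfl fun r hr => ?_)) h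
  have := Finset.mem_range.mp hr
  rw [show N - r = N - 1 - r + 1 by omega]
  push_cast
  rfl

theorem sum_range_log_sub (n : ℕ) :
    ∑ r ∈ Finset.range n, Real.log (n - r : ℕ) = Real.log n.factorial := by
  rw [← Nat.descFactorial_self, Nat.descFactorial_eq_prod_range, Nat.cast_prod, Real.log_prod]
  intro r hr
  have := Finset.mem_range.mp hr
  have : n - r ≠ 0 := by omega
  exact_mod_cast this

theorem boxAllowedSymbols_mono {n : ℕ} (x : ℕ) (Y Z : Finset (Fin n)) (m : ℕ) (j : Fin n) (r : ℕ)
    (hr : r < m) : boxAllowedSymbols x Y Z r j ⊆ boxAllowedSymbols x Y Z m j := by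
  unfold boxAllowedSymbols
  split_ifs with h1 h2 h2
  · exact subset_rfl
  · exact Finset.subset_univ _
  · exact absurd ⟨hr.trans h2.1, h2.2⟩ h1
  · exact subset_rfl

theorem sum_bregmanLog_boxAllowedSymbols_le {n x : ℕ} {Y Z : Finset (Fin n)} {r : ℕ} (hrn : r < n)
    (hpos : ∀ j, r < (boxAllowedSymbols x Y Z r j).card) :
    ∑ j, bregmanLog ((boxAllowedSymbols x Y Z r j).card - r) ≤
      n * (Real.log (n - r : ℕ) - 1) + n * (Real.log n + 1) * ((n - r : ℕ) : ℝ)⁻¹ +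
      if r < x then n * (Real.log n + 1) * ((n - Z.card - r : ℕ) : ℝ)⁻¹ - Y.card * Z.card / n
        else 0 := by
  have hl : 0 ≤ Real.log n + 1 := by
    have := Real.log_natCast_nonneg n
    linarith
  have h : ∀ j, bregmanLog ((boxAllowedSymbols x Y Z r j).card - r) ≤
      (Real.log (n - r : ℕ) - 1) + (Real.log n + 1) * ((n - r : ℕ) : ℝ)⁻¹ +
      if r < x then (Real.log n + 1) * ((n - Z.card - r : ℕ) : ℝ)⁻¹ -
        (if j ∈ Y then (Z.card : ℝ) / n else 0) else 0 := by
    intro j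
    have h1 := hpos j
    have hinv : 0 ≤ (Real.log n + 1) * ((n - r : ℕ) : ℝ)⁻¹ := by positivity
    have hinv' : 0 ≤ (Real.log n + 1) * ((n - Z.card - r : ℕ) : ℝ)⁻¹ := by positivity
    have hfull := bregmanLog_le (d := n - r) (n := n) (by omega) (by omega)
    unfold boxAllowedSymbols at h1 ⊢
    by_cases hx : r < x
    · by_cases hj : j ∈ Y
      · simp only [hx, hj, and_self, if_true, Finset.card_compl, Fintype.card_fin] at h1 ⊢
        have h2 := bregmanLog_le (d := n - Z.card - r) (n := n) (by omega) (by omega)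
        have h3 := log_sub_le (d := n - r) (z := Z.card) (n := n) (by omega) (by omega)
        rw [show n - r - Z.card = n - Z.card - r by omega] at h3
        linarith
      · simp only [hx, hj, and_false, if_true, if_false, Finset.card_univ, Fintype.card_fin]
        linarith
    · simp only [hx, false_and, if_false, Finset.card_univ, Fintype.card_fin]
      linarith
  refine (Finset.sum_le_sum fun j _ => h j).trans (le_of_eq ?_)
  by_cases hx : r < x
  · simp only [hx, if_true, Finset.sum_add_distrib, Finset.sum_sub_distrib, Finset.sum_const,
      nsmul_eq_mul, Finset.card_univ, Fintype.card_fin, ← Finset.sum_filter,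
      Finset.filter_univ_mem]
    ring
  · simp only [hx, if_false, Finset.sum_add_distrib, Finset.sum_sub_distrib, Finset.sum_const,
      nsmul_eq_mul, Finset.card_univ, Fintype.card_fin]
    ring

open Classical in
theorem card_filter_isEmptyBox_le_exp {n : ℕ} (X Z : Finset (Fin n)) {Y : Finset (Fin n)}
    (hY : Y.Nonempty) :
    (((latinSquares n).filter fun L => IsEmptyBox L X Y Z).card : ℝ) ≤
      (n.factorial : ℝ) ^ n * Real.exp (-(n * n : ℝ)) *
        Real.exp (2 * n * (Real.log n + 1) ^ 2 - X.card * Y.card * Z.card / n) := by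
  refine (Nat.cast_le.mpr (card_filter_isEmptyBox_le X Y Z)).trans ?_
  rcases (latinRectangles (boxAllowedSymbols X.card Y Z) n).eq_empty_or_nonempty with h0 | h0
  · rw [h0]
    simp only [Finset.card_empty, Nat.cast_zero]
    positivity
  obtain ⟨hpos, hlog⟩ := log_card_latinRectangles_le (boxAllowedSymbols_mono X.card Y Z) n h0
  have hX : X.card ≤ n := by simpa using Finset.card_le_univ X
  have hl : 0 ≤ Real.log n + 1 := by
    have := Real.log_natCast_nonneg n
    linarith
  obtain ⟨j, hj⟩ := hY
  -- A column of Y carries distinct symbols outside Z in its first |X| cells; hence the harmonic sum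
  -- of the restricted rows stops before its denominator reaches 0.
  have hXZ : X.card ≤ n - Z.card := by
    by_contra hlt
    have hr : n - Z.card < n := by omega
    have := hpos (n - Z.card) hr j
    simp only [boxAllowedSymbols, hj, and_true] at this
    rw [if_pos (by omega), Finset.card_compl, Fintype.card_fin] at this
    omega
  have h1 := hlog.trans (Finset.sum_le_sum fun r hr =>
    sum_bregmanLog_boxAllowedSymbols_le (Finset.mem_range.mp hr) (hpos r (Finset.mem_range.mp hr)))
  have h2 : ∑ r ∈ Finset.range n, (if r < X.card then
      n * (Real.log n + 1) * ((n - Z.card - r : ℕ) : ℝ)⁻¹ - Y.card * Z.card / n else 0 : ℝ) ≤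
      n * (Real.log n + 1) * (1 + Real.log n) - X.card * (Y.card * Z.card / n) := by
    rw [← Finset.sum_filter]
    have : (Finset.range n).filter (· < X.card) = Finset.range X.card := by
      ext r
      simp only [Finset.mem_filter, Finset.mem_range]
      omega
    rw [this, Finset.sum_sub_distrib, Finset.sum_const, nsmul_eq_mul, Finset.card_range,
      ← Finset.mul_sum]
    refine sub_le_sub_right (mul_le_mul_of_nonneg_left ?_ (by positivity)) _
    refine (Finset.sum_le_sum_of_subset_of_nonneg (Finset.range_mono hXZ)
      fun _ _ _ => by positivity).trans ((sum_range_inv_sub_le _).trans ?_)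
    rcases Nat.eq_zero_or_pos (n - Z.card) with h | h
    · rw [h]
      have := Real.log_natCast_nonneg n
      simpa using this
    · have := Real.log_le_log (Nat.cast_pos.mpr h) (Nat.cast_le.mpr (Nat.sub_le n Z.card))
      linarith
  -- This harmonic error and the one in `h2` each contribute at most n (log n + 1)², whence the
  -- factor 2 in the exponent.
  have h3 := mul_le_mul_of_nonneg_left (sum_range_inv_sub_le n)
    (mul_nonneg (Nat.cast_nonneg n) hl)
  rw [Finset.sum_add_distrib, Finset.sum_add_distrib, ← Finset.mul_sum, ← Finset.mul_sum,
    Finset.sum_sub_distrib, sum_range_log_sub, Finset.sum_const, Finset.card_range, nsmul_eq_mul,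
    mul_one] at h1
  rw [← Real.exp_log (pow_pos (Nat.cast_pos.mpr n.factorial_pos) n : (0 : ℝ) < _), Real.log_pow,
    ← Real.exp_add, ← Real.exp_add,
    ← Real.log_le_iff_le_exp (by exact_mod_cast Finset.card_pos.mpr h0)]
  have h4 : (X.card : ℝ) * (Y.card * Z.card / n) = X.card * Y.card * Z.card / n := by ring
  rw [h4] at h2
  nlinarith

/-! ### Union bound over boxes and conclusion -/

theorem exists_isEmptyBox_of_lt_maxEmptyBoxVolume {n : ℕ} {L : Fin n → Fin n → Fin n} {V : ℝ}
    (hV : 0 ≤ V) (h : V < maxEmptyBoxVolume L) :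
    ∃ X Y Z : Finset (Fin n), IsEmptyBox L X Y Z ∧ V < X.card * Y.card * Z.card := by
  classical
  by_contra! hcon
  refine h.not_ge ((Nat.cast_le.mpr ?_).trans (Nat.floor_le hV))
  refine Finset.sup_le fun T hT => Nat.le_floor ?_
  push_cast
  exact hcon _ _ _ (Finset.mem_filter.mp hT).2

open Classical in
theorem card_filter_lt_maxEmptyBoxVolume_le {n : ℕ} {V : ℝ} (hV : 0 ≤ V) :
    (((latinSquares n).filter fun L => V < maxEmptyBoxVolume L).card : ℝ) ≤
      (latinSquares n).card *
        Real.exp (3 * n + 2 * n * (Real.log n + 1) ^ 2 - V / n) := by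
  let boxes := (Finset.univ : Finset (Finset (Fin n) × Finset (Fin n) × Finset (Fin n))).filter
    fun T => V < T.1.card * T.2.1.card * T.2.2.card
  have hsub : ((latinSquares n).filter fun L => V < maxEmptyBoxVolume L) ⊆
      boxes.biUnion fun T => (latinSquares n).filter fun L => IsEmptyBox L T.1 T.2.1 T.2.2 := by
    intro L hL
    obtain ⟨hL1, hL2⟩ := Finset.mem_filter.mp hL
    obtain ⟨X, Y, Z, hE, hlt⟩ := exists_isEmptyBox_of_lt_maxEmptyBoxVolume hV hL2
    exact Finset.mem_biUnion.mpr ⟨(X, Y, Z), Finset.mem_filter.mpr ⟨Finset.mem_univ _, hlt⟩,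
      Finset.mem_filter.mpr ⟨hL1, hE⟩⟩
  have hbox : ∀ T ∈ boxes,
      (((latinSquares n).filter fun L => IsEmptyBox L T.1 T.2.1 T.2.2).card : ℝ) ≤
        (latinSquares n).card * Real.exp (2 * n * (Real.log n + 1) ^ 2 - V / n) := by
    intro T hT
    have hvol : V < T.1.card * T.2.1.card * T.2.2.card := (Finset.mem_filter.mp hT).2
    have hY : T.2.1.Nonempty := by
      rw [Finset.nonempty_iff_ne_empty]
      intro h
      rw [h] at hvol
      simp only [Finset.card_empty, Nat.cast_zero, mul_zero, zero_mul] at hvol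
      linarith
    refine (card_filter_isEmptyBox_le_exp T.1 T.2.2 hY).trans ?_
    refine mul_le_mul (pow_mul_exp_le_card_latinSquares n) (Real.exp_le_exp.mpr ?_)
      (Real.exp_pos _).le (Nat.cast_nonneg _)
    gcongr
  -- There are 8^n triples of subsets, and 2 ≤ e.
  have hcard : (boxes.card : ℝ) ≤ Real.exp (3 * n) := by
    have h1 : boxes.card ≤ 2 ^ n * (2 ^ n * 2 ^ n) := by
      refine (Finset.card_le_univ _).trans (le_of_eq ?_)
      simp
    have h2 : (2 : ℝ) ≤ Real.exp 1 := by
      have := Real.add_one_le_exp (1 : ℝ)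
      linarith
    have h3 : (2 : ℝ) ^ n ≤ Real.exp n := by
      refine (pow_le_pow_left₀ (by norm_num) h2 n).trans (le_of_eq ?_)
      rw [← Real.exp_nat_mul, mul_one]
    calc (boxes.card : ℝ) ≤ 2 ^ n * (2 ^ n * 2 ^ n) := by exact_mod_cast h1
      _ ≤ Real.exp n * (Real.exp n * Real.exp n) := by gcongr
      _ = Real.exp (3 * n) := by rw [← Real.exp_add, ← Real.exp_add]; ring_nf
  calc (((latinSquares n).filter fun L => V < maxEmptyBoxVolume L).card : ℝ)
      ≤ ∑ T ∈ boxes, (((latinSquares n).filter fun L => IsEmptyBox L T.1 T.2.1 T.2.2).card : ℝ) := by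
        exact_mod_cast (Finset.card_le_card hsub).trans Finset.card_biUnion_le
    _ ≤ boxes.card * ((latinSquares n).card *
          Real.exp (2 * n * (Real.log n + 1) ^ 2 - V / n)) := by
        rw [← nsmul_eq_mul]
        exact Finset.sum_le_card_nsmul _ _ _ hbox
    _ ≤ Real.exp (3 * n) * ((latinSquares n).card *
          Real.exp (2 * n * (Real.log n + 1) ^ 2 - V / n)) := by gcongr
    _ = _ := by
        rw [mul_left_comm, ← Real.exp_add]
        ring_nf

theorem card_latinSquares_pos (n : ℕ) : (0 : ℝ) < (latinSquares n).card :=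
  lt_of_lt_of_le (by positivity) (pow_mul_exp_le_card_latinSquares n)

theorem latinSquareProb_le_one (n : ℕ) (P : (Fin n → Fin n → Fin n) → Prop) :
    latinSquareProb n P ≤ 1 := by
  classical
  rw [latinSquareProb, div_le_one (card_latinSquares_pos n)]
  exact Nat.cast_le.mpr (Finset.card_filter_le _ _)

theorem one_sub_exp_neg_le_latinSquareProb {n : ℕ} (hn : 3 ≤ n) :
    1 - Real.exp (-(n : ℝ)) ≤ latinSquareProb n
      (fun L => (maxEmptyBoxVolume L : ℝ) ≤ 12 * ((n : ℝ) ^ 2 * Real.log (n : ℝ) ^ 2)) := by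
  classical
  have hn' : (3 : ℝ) ≤ n := by exact_mod_cast hn
  have hlog : 1 ≤ Real.log n := by
    rw [Real.le_log_iff_exp_le (by linarith)]
    exact (Real.exp_one_lt_d9.le.trans (by norm_num)).trans hn'
  have h1 := card_filter_lt_maxEmptyBoxVolume_le (n := n)
    (V := 12 * ((n : ℝ) ^ 2 * Real.log (n : ℝ) ^ 2)) (by positivity)
  have h2 := Finset.card_filter_add_card_filter_not (s := latinSquares n)
    fun L => (maxEmptyBoxVolume L : ℝ) ≤ 12 * ((n : ℝ) ^ 2 * Real.log (n : ℝ) ^ 2)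
  simp only [not_le] at h2
  have h3 := congrArg (Nat.cast : ℕ → ℝ) h2
  push_cast at h3
  rw [latinSquareProb, le_div_iff₀ (card_latinSquares_pos n)]
  have h4 : Real.exp (3 * n + 2 * n * (Real.log n + 1) ^ 2 -
      12 * ((n : ℝ) ^ 2 * Real.log (n : ℝ) ^ 2) / n) ≤ Real.exp (-(n : ℝ)) := by
    rw [Real.exp_le_exp]
    have h5 : 12 * ((n : ℝ) ^ 2 * Real.log (n : ℝ) ^ 2) / n = n * (12 * Real.log n ^ 2) := by
      field_simp
    rw [h5]
    -- The constant 12 comes from here: at log n = 1 equality holds, and n ≥ 3 guarantees log n ≥ 1.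
    -- The 4 is the 3 from the number of boxes plus 1 for the target e^{-n}.
    have h6 : 4 + 2 * (Real.log n + 1) ^ 2 - 12 * Real.log n ^ 2 ≤ 0 := by nlinarith
    nlinarith
  have h7 := mul_le_mul_of_nonneg_left h4 (card_latinSquares_pos n).le
  have h8 : (((latinSquares n).filter fun L => (maxEmptyBoxVolume L : ℝ) ≤
      12 * ((n : ℝ) ^ 2 * Real.log (n : ℝ) ^ 2)).card : ℝ) ≥
      (1 - Real.exp (-(n : ℝ))) * (latinSquares n).card := by
    linarith
  convert h8 using 3

theorem mainTheorem4 :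
    ∃ C : ℝ, 0 < C ∧
      Filter.Tendsto
        (fun n : ℕ => latinSquareProb n
          (fun L => (maxEmptyBoxVolume L : ℝ) ≤ C * ((n : ℝ) ^ 2 * Real.log (n : ℝ) ^ 2)))
        Filter.atTop (nhds 1) := by
  refine ⟨12, by norm_num, ?_⟩
  have h : Filter.Tendsto (fun n : ℕ => 1 - Real.exp (-(n : ℝ))) Filter.atTop (nhds 1) := by
    simpa using (Real.tendsto_exp_neg_atTop_nhds_zero.comp
      tendsto_natCast_atTop_atTop).const_sub (1 : ℝ)
  refine tendsto_of_tendsto_of_tendsto_of_le_of_le' h tendsto_const_nhds ?_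
    (Filter.Eventually.of_forall fun n => latinSquareProb_le_one n _)
  filter_upwards [Filter.eventually_ge_atTop 3] with n hn
  exact one_sub_exp_neg_le_latinSquareProb hn
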